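/- All Hilbert spaces are finite dimensional. A \emph{rank-one quantum game} $G$ is given by unit vectors $|\psi\rangle,|\gamma\rangle\in\mathcal H_A\otimes\mathcal H_B\otimes\mathcal H_C$: the referee prepares $|\psi\rangle$ and sends the registers $A$ and $B$ to Alice and Bob; after they return them, the referee measures $(A,B,C)$ with $P_1=|\gamma\rangle\langle\gamma|$, $P_0=1-P_1$, and outcome $1$ means that the players win. Let $M_{AB}=\mathrm{tr}_C\,|\psi\rangle\langle\gamma|$. The \emph{maximal value} is $V(G)=\|M_{AB}\|_{S_1(\mathcal H_A\otimes\mathcal H_B)}^2$ (the square of the trace norm); it represents the supremum of the winning probability of a single player who applies a quantum operation (a completely positive, trace preserving map) to $\mathcal H_A\otimes\mathcal H_B$. The \emph{entangled value with one-way communication} $\omega_{qow}(G)$ is the supremum of the winning probability over all auxiliary spaces $\mathcal H_{A'}$ and all quantum operations $T_{AA'}$, $S_{BA'}$, where $A'$ is initialized in $|0\rangle$, Alice applies $T_{AA'}$ to $\mathcal H_A\otimes\mathcal H_{A'}$ and sends $A'$ to Bob, who applies $S_{BA'}$ to $\mathcal H_B\otimes\mathcal H_{A'}$: $$\omega_{qow}(G)=\sup_{A',T,S}\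 \mathrm{tr}\Big(\big(|\gamma\rangle\langle\gamma|\otimes 1_{A'}\big)\,(S_{BA'}\otimes \mathrm{id}_{AC})\,(T_{AA'}\otimes\mathrm{id}_{BC})\big(|\psi\rangle\langle\psi|\otimes|0\rangle\langle 0|\big)\Big).$$ The parallel repetition $G^2$ is the rank-one quantum game with initial state $|\psi\rangle\otimes|\psi\rangle$ and measurement state $|\gamma\rangle\otimes|\gamma\rangle$, Alice, Bob and the referee each holding both copies of their register. For $n\ge1$ let $G_{C+R}$ be the game with $\mathcal H_A=\mathcal H_B=\mathbb C^n$, $\mathcal H_C=\mathbb C^n\otimes\mathbb C^2$, $$|\psi\rangle=\frac1{\sqrt{2n}}\sum_{i=1}^n\big(|i1\rangle_{AB}|i1\rangle_C+|1i\rangle_{AB}|i2\rangle_C\big),\qquad |\gamma\rangle=\frac1{\sqrt{2n}}\sum_{i=1}^n\big(|1i\rangle_{AB}|i1\rangle_C+|i1\rangle_{AB}|i2\rangle_C\big).$$ \textbf{Lemma.} For every integer $n\ge 1$: \begin{enumerate} \item $V(G_{C+R})=V(G_{C+R}^2)=1$; also the supremum of the winning probability of a single player with access to both $\mathcal H_A$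 and $\mathcal H_B$ equals $1$ for $G_{C+R}$ and for $G_{C+R}^2$. \item $\omega_{qow}(G_{C+R})=\frac14\big(1+\frac1n\big)^2$ and $\omega_{qow}(G_{C+R}^2)=\frac1{16}\big(1+\frac1n\big)^4$. \end{enumerate} -/

import Mathlib

open scoped Kronecker Matrix ComplexOrder

noncomputable section

namespace QGame

section Operations

variable {X Y : Type} [Fintype X] [DecidableEq X] [Fintype Y] [DecidableEq Y]

/-- The map `T ⊗ id` on matrices over `ℂ^X ⊗ ℂ^E`: it applies `T` to each block
`(⟨e| ρ |e'⟩)`, a matrix over `ℂ^X`, for `e, e'` in the canonical basis of `ℂ^E`. -/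
def ampliate (T : Matrix X X ℂ →ₗ[ℂ] Matrix Y Y ℂ) {E : Type}
    (ρ : Matrix (X × E) (X × E) ℂ) : Matrix (Y × E) (Y × E) ℂ :=
  fun p q => T (fun x x' => ρ (x, p.2) (x', q.2)) p.1 q.1

/-- A quantum operation (quantum channel): a completely positive, trace preserving linear map. -/
structure IsQuantumOperation (T : Matrix X X ℂ →ₗ[ℂ] Matrix Y Y ℂ) : Prop where
  completelyPositive : ∀ (k : ℕ) (ρ : Matrix (X × Fin k) (X × Fin k) ℂ),
    ρ.PosSemidef → (ampliate T ρ).PosSemidef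
  tracePreserving : ∀ ρ : Matrix X X ℂ, (T ρ).trace = ρ.trace

/-- The rank-one operator `|v⟩⟨v|`. -/
def ketbra (v : X → ℂ) : Matrix X X ℂ := Matrix.vecMulVec v (star v)

/-- The trace norm (`S_1`-norm): the sum of the singular values of `M`, which are the square roots
of the eigenvalues of `Mᴴ M`. -/
def traceNorm (M : Matrix X X ℂ) : ℝ :=
  ∑ i, √((Matrix.isHermitian_conjTranspose_mul_self M).eigenvalues i)

end Operations

/-- A rank-one quantum game: an initial state `ψ` and a measurement state `γ`, unit vectors in
`H_A ⊗ H_B ⊗ H_C` with `H_A = ℂ^A`, `H_B = ℂ^B`, `H_C = ℂ^C`. -/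
structure RankOneGame (A B C : Type) [Fintype A] [Fintype B] [Fintype C] where
  ψ : A × B × C → ℂ
  γ : A × B × C → ℂ
  norm_ψ : ∑ x, ‖ψ x‖ ^ 2 = 1
  norm_γ : ∑ x, ‖γ x‖ ^ 2 = 1

namespace RankOneGame

section Values

variable {A B C : Type} [Fintype A] [DecidableEq A] [Fintype B] [DecidableEq B]
  [Fintype C] [DecidableEq C]

/-- The operator `M_AB = tr_C |ψ⟩⟨γ|` on `H_A ⊗ H_B`. -/
def M (G : RankOneGame A B C) : Matrix (A × B) (A × B) ℂ :=
  fun p q => ∑ c, G.ψ (p.1, p.2, c) * star (G.γ (q.1, q.2, c))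

/-- The maximal value `V(G) = ‖M_AB‖²` for the norm of `S_1(H_A ⊗ H_B)`. -/
def V (G : RankOneGame A B C) : ℝ := traceNorm G.M ^ 2

/-- Winning probability of one player who holds both registers `A` and `B` and applies the quantum
operation `T` to them: `tr (|γ⟩⟨γ| (T ⊗ id_C)(|ψ⟩⟨ψ|))`. -/
def singleWinProb (G : RankOneGame A B C)
    (T : Matrix (A × B) (A × B) ℂ →ₗ[ℂ] Matrix (A × B) (A × B) ℂ) : ℝ :=
  let ρ₀ : Matrix ((A × B) × C) ((A × B) × C) ℂ :=
    ketbra fun x => G.ψ (x.1.1, x.1.2, x.2)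
  let ρ₁ : Matrix (A × B × C) (A × B × C) ℂ :=
    (ampliate T ρ₀).submatrix (fun x => ((x.1, x.2.1), x.2.2)) (fun x => ((x.1, x.2.1), x.2.2))
  (ketbra G.γ * ρ₁).trace.re

/-- The optimal winning probability of one player with access to both `H_A` and `H_B`. -/
def singlePlayerValue (G : RankOneGame A B C) : ℝ :=
  sSup {p | ∃ T : Matrix (A × B) (A × B) ℂ →ₗ[ℂ] Matrix (A × B) (A × B) ℂ,
    IsQuantumOperation T ∧ p = G.singleWinProb T}

/-- Winning probability with one-way quantum communication. The auxiliary register `A'`, with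
`H_{A'} = ℂ^(d+1)`, starts in `|0⟩`. Alice applies `T` to `H_A ⊗ H_{A'}` and sends `A'` to Bob, who
applies `S` to `H_B ⊗ H_{A'}`; then `A, B, C` are measured with `P₁ = |γ⟩⟨γ|`:
`tr ((|γ⟩⟨γ| ⊗ 1_{A'}) (S ⊗ id_{AC}) (T ⊗ id_{BC}) (|ψ⟩|0⟩⟨ψ|⟨0|))`.
The `submatrix` operations only regroup the four registers. -/
def qowWinProb (G : RankOneGame A B C) (d : ℕ)
    (T : Matrix (A × Fin (d + 1)) (A × Fin (d + 1)) ℂ →ₗ[ℂ]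
      Matrix (A × Fin (d + 1)) (A × Fin (d + 1)) ℂ)
    (S : Matrix (B × Fin (d + 1)) (B × Fin (d + 1)) ℂ →ₗ[ℂ]
      Matrix (B × Fin (d + 1)) (B × Fin (d + 1)) ℂ) : ℝ :=
  let ρ₀ : Matrix ((A × Fin (d + 1)) × (B × C)) ((A × Fin (d + 1)) × (B × C)) ℂ :=
    ketbra fun x => G.ψ (x.1.1, x.2.1, x.2.2) * (if x.1.2 = 0 then 1 else 0)
  let toBob : (B × Fin (d + 1)) × (A × C) → (A × Fin (d + 1)) × (B × C) :=
    fun x => ((x.2.1, x.1.2), (x.1.1, x.2.2))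
  let ρ₁ : Matrix ((B × Fin (d + 1)) × (A × C)) ((B × Fin (d + 1)) × (A × C)) ℂ :=
    (ampliate T ρ₀).submatrix toBob toBob
  let toReferee : (A × B × C) × Fin (d + 1) → (B × Fin (d + 1)) × (A × C) :=
    fun x => ((x.1.2.1, x.2), (x.1.1, x.1.2.2))
  let ρ₂ : Matrix ((A × B × C) × Fin (d + 1)) ((A × B × C) × Fin (d + 1)) ℂ :=
    (ampliate S ρ₁).submatrix toReferee toReferee
  ((ketbra G.γ ⊗ₖ (1 : Matrix (Fin (d + 1)) (Fin (d + 1)) ℂ)) * ρ₂).trace.re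

/-- The entangled value with one-way communication (from Alice to Bob): the supremum of the winning
probability over all finite-dimensional `H_{A'}` and all quantum operations of Alice and Bob. -/
def omegaQow (G : RankOneGame A B C) : ℝ :=
  sSup {p | ∃ (d : ℕ)
    (T : Matrix (A × Fin (d + 1)) (A × Fin (d + 1)) ℂ →ₗ[ℂ]
      Matrix (A × Fin (d + 1)) (A × Fin (d + 1)) ℂ)
    (S : Matrix (B × Fin (d + 1)) (B × Fin (d + 1)) ℂ →ₗ[ℂ]
      Matrix (B × Fin (d + 1)) (B × Fin (d + 1)) ℂ),
    IsQuantumOperation T ∧ IsQuantumOperation S ∧ p = G.qowWinProb d T S}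

end Values

section Repetition

variable {A B C : Type} [Fintype A] [Fintype B] [Fintype C]

theorem sum_tensor (f : A × B × C → ℂ) (hf : ∑ x, ‖f x‖ ^ 2 = 1) :
    ∑ x : (A × A) × (B × B) × (C × C),
      ‖f (x.1.1, x.2.1.1, x.2.2.1) * f (x.1.2, x.2.1.2, x.2.2.2)‖ ^ 2 = 1 := by
  have h : ∑ x : (A × B × C) × (A × B × C), ‖f x.1 * f x.2‖ ^ 2 = 1 := by
    simp_rw [norm_mul, mul_pow]
    rw [Fintype.sum_prod_type]
    simp_rw [← Finset.mul_sum, hf, mul_one]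
    exact hf
  rw [← h]
  exact Fintype.sum_equiv
    ⟨fun x => ((x.1.1, x.2.1.1, x.2.2.1), (x.1.2, x.2.1.2, x.2.2.2)),
      fun y => ((y.1.1, y.2.1), (y.1.2.1, y.2.2.1), (y.1.2.2, y.2.2.2)),
      fun _ => rfl, fun _ => rfl⟩ _ _ (fun _ => rfl)

/-- The two-fold parallel repetition `G²`: the rank-one quantum game with initial state `ψ ⊗ ψ` and
measurement `(|γ⟩⟨γ|) ⊗ (|γ⟩⟨γ|)`, where each party holds both copies of its register. -/
def sq (G : RankOneGame A B C) : RankOneGame (A × A) (B × B) (C × C) where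
  ψ x := G.ψ (x.1.1, x.2.1.1, x.2.2.1) * G.ψ (x.1.2, x.2.1.2, x.2.2.2)
  γ x := G.γ (x.1.1, x.2.1.1, x.2.2.1) * G.γ (x.1.2, x.2.1.2, x.2.2.2)
  norm_ψ := sum_tensor _ G.norm_ψ
  norm_γ := sum_tensor _ G.norm_γ

end Repetition

end RankOneGame

section CR

variable (n : ℕ) [NeZero n]

/-- `(2n)^(-1/2) ∑_i (|i 1⟩_AB |i 1⟩_C + |1 i⟩_AB |i 2⟩_C)`, where `H_A = H_B = ℂ^n` and
`H_C = ℂ^n ⊗ ℂ^2`. The basis vector `|1⟩` of `ℂ^n` has index `0`, and `|1⟩, |2⟩` of `ℂ^2` have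
the indices `0, 1`. -/
def psiCR : Fin n × Fin n × (Fin n × Fin 2) → ℂ := fun x =>
  ((1 / √(2 * n) : ℝ) : ℂ) *
    ∑ i : Fin n, ((if x = (i, 0, (i, 0)) then 1 else 0) + (if x = (0, i, (i, 1)) then 1 else 0))

/-- `(2n)^(-1/2) ∑_i (|1 i⟩_AB |i 1⟩_C + |i 1⟩_AB |i 2⟩_C)`. -/
def gammaCR : Fin n × Fin n × (Fin n × Fin 2) → ℂ := fun x =>
  ((1 / √(2 * n) : ℝ) : ℂ) *
    ∑ i : Fin n, ((if x = (0, i, (i, 0)) then 1 else 0) + (if x = (i, 0, (i, 1)) then 1 else 0))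

theorem normCR_aux (f : Fin n × Fin n × (Fin n × Fin 2) → ℂ) (u v : Fin 2)
    (huv : (u = 0 ∧ v = 1) ∨ (u = 1 ∧ v = 0))
    (hf : ∀ x, f x = ((1 / √(2 * n) : ℝ) : ℂ) *
      ∑ i : Fin n, ((if x = (i, 0, (i, u)) then 1 else 0) +
        (if x = (0, i, (i, v)) then 1 else 0))) :
    ∑ x, ‖f x‖ ^ 2 = 1 := by
  have hn : (n : ℝ) ≠ 0 := Nat.cast_ne_zero.mpr (NeZero.ne n)
  have h1 : ∀ a b k, f (a, b, (k, u)) =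
      if a = k then (if b = 0 then ((1 / √(2 * n) : ℝ) : ℂ) else 0) else 0 := by
    intro a b k
    rw [hf]
    rcases huv with ⟨rfl, rfl⟩ | ⟨rfl, rfl⟩ <;>
    · by_cases ha : a = k <;> by_cases hb : b = 0 <;>
        simp [Prod.mk.injEq, ha, hb, ite_and]
      try exact fun h => absurd h.symm ha
  have h2 : ∀ a b k, f (a, b, (k, v)) =
      if b = k then (if a = 0 then ((1 / √(2 * n) : ℝ) : ℂ) else 0) else 0 := by
    intro a b k
    rw [hf]
    rcases huv with ⟨rfl, rfl⟩ | ⟨rfl, rfl⟩ <;>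
    · by_cases ha : a = 0 <;> by_cases hb : b = k <;>
        simp [Prod.mk.injEq, ha, hb, ite_and]
      try exact fun h => absurd h.symm hb
  have hs : ∀ g : Fin 2 → ℝ, ∑ s, g s = g u + g v := by
    intro g
    rcases huv with ⟨rfl, rfl⟩ | ⟨rfl, rfl⟩ <;> simp [Fin.sum_univ_two, add_comm]
  have hc : ‖((1 / √(2 * n) : ℝ) : ℂ)‖ ^ 2 = 1 / (2 * n) := by
    rw [Complex.norm_real, Real.norm_eq_abs, sq_abs, div_pow, Real.sq_sqrt (by positivity), one_pow]
  simp only [Fintype.sum_prod_type, hs, h1, h2, Finset.sum_add_distrib, apply_ite norm, norm_zero,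
    ite_pow, hc]
  simp [Finset.sum_ite_eq]
  field_simp
  norm_num

theorem norm_psiCR : ∑ x, ‖psiCR n x‖ ^ 2 = 1 :=
  normCR_aux n _ 0 1 (.inl ⟨rfl, rfl⟩) fun _ => rfl

theorem norm_gammaCR : ∑ x, ‖gammaCR n x‖ ^ 2 = 1 :=
  normCR_aux n _ 1 0 (.inr ⟨rfl, rfl⟩) fun x => by
    simp only [gammaCR, add_comm]

/-- The game `G_{C+R}`. -/
def gameCR : RankOneGame (Fin n) (Fin n) (Fin n × Fin 2) where
  ψ := psiCR n
  γ := gammaCR n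
  norm_ψ := norm_psiCR n
  norm_γ := norm_gammaCR n

end CR

end QGame

end

/-!
With a single player, the winning probability for Kraus operators `K_r` on `A B` is
`∑_r |tr (M_AB K_r)|²`. In a singular value decomposition of `M_AB` this is at most `‖M_AB‖_{S_1}²`
by Minkowski's inequality in `ℓ²(r)`, and the unitary that turns `M_AB` into its absolute value
attains the bound, so that the single-player value is `V(G)`.

The operator `M_AB` of `G_{C+R}` is a weighted swap `|a⟩|x⟩ ↦ m(x, a) |x⟩|a⟩` with `m ≥ 0`, hence so
is that of `G_{C+R}²`, with product weights. For such a game `V(G) = (∑_{a,x} m(a, x))²`, and the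
one-way value is `(∑_a max_x m(a, x))²`: the winning amplitude is a sum over `a` of vectors, indexed
by the Kraus operators and the final message, of norm at most `max_x m(a, x)`, so that Minkowski's
inequality gives the upper bound. It is attained when Alice permutes the basis of `A A'` so that
`|a⟩|0⟩` gets an optimal `x` in its first entry, and Bob applies the inverse permutation. Both sums
are multiplicative under `G ↦ G²`.
-/

noncomputable section

namespace QGame

open Matrix

section Ketbra

variable {X D : Type} [Fintype X]

theorem ofReal_sum_norm_sq (v : X → ℂ) : ((∑ x, ‖v x‖ ^ 2 : ℝ) : ℂ) = star v ⬝ᵥ v := by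
  simp [dotProduct, Complex.conj_mul']

theorem re_trace_ketbra_mul_ketbra (γ φ : X → ℂ) :
    (ketbra γ * ketbra φ).trace.re = ‖star γ ⬝ᵥ φ‖ ^ 2 := by
  have h : star φ ⬝ᵥ γ = star (star γ ⬝ᵥ φ) := by rw [star_dotProduct]
  rw [ketbra, ketbra, vecMulVec_mul_vecMulVec, trace_vecMulVec, dotProduct_smul,
    dotProduct_comm γ, h, smul_eq_mul, Complex.star_def, Complex.mul_conj, Complex.ofReal_re,
    Complex.normSq_eq_norm_sq]

theorem trace_kronecker_one_mul [Fintype D] [DecidableEq D] (P : Matrix X X ℂ)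
    (Q : Matrix (X × D) (X × D) ℂ) :
    ((P ⊗ₖ (1 : Matrix D D ℂ)) * Q).trace = ∑ w, (P * Q.submatrix (·, w) (·, w)).trace := by
  simp only [trace, diag_apply, mul_apply, Fintype.sum_prod_type, kroneckerMap_apply, one_apply,
    mul_ite, mul_one, mul_zero, ite_mul, zero_mul, Finset.sum_ite_eq, Finset.mem_univ, if_true,
    submatrix_apply]
  exact Finset.sum_comm

theorem re_trace_ketbra_kronecker_one_mul_ketbra [Fintype D] [DecidableEq D] (γ : X → ℂ)
    (φ : X × D → ℂ) :
    ((ketbra γ ⊗ₖ (1 : Matrix D D ℂ)) * ketbra φ).trace.re =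
      ∑ w, ‖star γ ⬝ᵥ fun x => φ (x, w)‖ ^ 2 := by
  rw [trace_kronecker_one_mul, Complex.re_sum]
  exact Finset.sum_congr rfl fun w _ => re_trace_ketbra_mul_ketbra γ fun x => φ (x, w)

end Ketbra

section Kraus

variable {R X Y : Type} [Fintype R]

theorem sum_norm_sq_kraus_col [Fintype Y] [DecidableEq X] {K : R → Matrix Y X ℂ}
    (hK : ∑ r, (K r)ᴴ * K r = 1) (x : X) : ∑ r, ∑ y, ‖K r y x‖ ^ 2 = 1 := by
  apply Complex.ofReal_injective
  simpa [Matrix.sum_apply, mul_apply, Complex.conj_mul'] using congrFun (congrFun hK x) x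

variable [Fintype X]

/-- The completely positive map `ρ ↦ ∑ r, K r ρ (K r)ᴴ` with Kraus operators `K r`. It is trace
preserving when `∑ r, (K r)ᴴ * K r = 1`. -/
def krausMap (K : R → Matrix Y X ℂ) : Matrix X X ℂ →ₗ[ℂ] Matrix Y Y ℂ where
  toFun ρ := ∑ r, K r * ρ * (K r)ᴴ
  map_add' ρ σ := by simp only [Matrix.mul_add, Matrix.add_mul, Finset.sum_add_distrib]
  map_smul' c ρ := by
    simp only [Matrix.mul_smul, Matrix.smul_mul, Finset.smul_sum, RingHom.id_apply]

theorem krausMap_apply (K : R → Matrix Y X ℂ) (ρ : Matrix X X ℂ) :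
    krausMap K ρ = ∑ r, K r * ρ * (K r)ᴴ := rfl

theorem krausMap_single [DecidableEq X] (K : R → Matrix Y X ℂ) (x x' : X) (y y' : Y) :
    krausMap K (single x x' 1) y y' = ∑ r, K r y x * star (K r y' x') := by
  simp [krausMap_apply, Matrix.sum_apply, mul_apply, single_apply, ite_and]

theorem posSemidef_krausMap [Finite Y] (K : R → Matrix Y X ℂ) {ρ : Matrix X X ℂ}
    (hρ : ρ.PosSemidef) : (krausMap K ρ).PosSemidef :=
  posSemidef_sum _ fun r _ => hρ.mul_mul_conjTranspose_same (K r)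

theorem trace_krausMap [Fintype Y] (K : R → Matrix Y X ℂ) (ρ : Matrix X X ℂ) :
    (krausMap K ρ).trace = ((∑ r, (K r)ᴴ * K r) * ρ).trace := by
  simp only [krausMap_apply, trace_sum, Finset.sum_mul]
  exact Finset.sum_congr rfl fun r _ => by rw [trace_mul_comm, ← Matrix.mul_assoc]

theorem ampliate_krausMap {E : Type} [Fintype E] [DecidableEq E] (K : R → Matrix Y X ℂ)
    (ρ : Matrix (X × E) (X × E) ℂ) :
    ampliate (krausMap K) ρ = krausMap (fun r => K r ⊗ₖ (1 : Matrix E E ℂ)) ρ := by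
  ext ⟨y, e⟩ ⟨y', e'⟩
  change krausMap K (of fun x x' => ρ (x, e) (x', e')) y y' = _
  simp [krausMap_apply, Matrix.sum_apply, mul_apply, Fintype.sum_prod_type, one_apply, apply_ite]

theorem isQuantumOperation_krausMap [Fintype Y] [DecidableEq X] {K : R → Matrix Y X ℂ}
    (hK : ∑ r, (K r)ᴴ * K r = 1) : IsQuantumOperation (krausMap K) where
  completelyPositive k ρ hρ := by
    rw [ampliate_krausMap]
    exact posSemidef_krausMap _ hρ
  tracePreserving ρ := by rw [trace_krausMap, hK, Matrix.one_mul]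

/-- The vector `∑ x, |x⟩|x⟩`, where the second register is indexed by `Fin (card X)`. Applying
`T ⊗ id` to its outer product gives the Choi matrix of `T`. -/
def maxEntangled (X : Type) [Fintype X] : X × Fin (Fintype.card X) → ℂ :=
  fun p => if Fintype.equivFin X p.1 = p.2 then 1 else 0

theorem ampliate_ketbra_maxEntangled [DecidableEq X] (T : Matrix X X ℂ →ₗ[ℂ] Matrix Y Y ℂ)
    (x x' : X) (y y' : Y) :
    ampliate T (ketbra (maxEntangled X)) (y, Fintype.equivFin X x) (y', Fintype.equivFin X x') =
      T (single x x' 1) y y' := by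
  have hblock : (fun a a' => ketbra (maxEntangled X) (a, Fintype.equivFin X x)
      (a', Fintype.equivFin X x')) = single x x' 1 := by
    ext a a'
    by_cases ha : x = a <;> by_cases ha' : x' = a' <;>
      simp [ketbra, vecMulVec_apply, maxEntangled, ha, ha', Ne.symm]
  rw [ampliate, hblock]

theorem exists_eq_krausMap [Finite Y] {T : Matrix X X ℂ →ₗ[ℂ] Matrix Y Y ℂ}
    (hT : (ampliate T (ketbra (maxEntangled X))).PosSemidef) :
    ∃ (k : ℕ) (K : Fin k → Matrix Y X ℂ), T = krausMap K := by
  classical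
  obtain ⟨k, v, hv⟩ := posSemidef_iff_eq_sum_vecMulVec.mp hT
  let K : Fin k → Matrix Y X ℂ := fun r => of fun y x => v r (y, Fintype.equivFin X x)
  refine ⟨k, K, ext_linearMap ℂ fun x x' => LinearMap.ext_ring (ext fun y y' => ?_)⟩
  change T (single x x' 1) y y' = krausMap K (single x x' 1) y y'
  rw [← ampliate_ketbra_maxEntangled, hv, krausMap_single]
  simp only [Matrix.sum_apply, vecMulVec_apply, Pi.star_apply, K, of_apply]

theorem IsQuantumOperation.exists_kraus [Fintype Y] [DecidableEq X]
    {T : Matrix X X ℂ →ₗ[ℂ] Matrix Y Y ℂ} (hT : IsQuantumOperation T) :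
    ∃ (k : ℕ) (K : Fin k → Matrix Y X ℂ), ∑ r, (K r)ᴴ * K r = 1 ∧ T = krausMap K := by
  obtain ⟨k, K, rfl⟩ := exists_eq_krausMap (T := T) <|
    hT.completelyPositive _ _ (posSemidef_vecMulVec_self_star (maxEntangled X))
  refine ⟨k, K, ext_iff_trace_mul_right.mpr fun ρ => ?_, rfl⟩
  rw [← trace_krausMap, hT.tracePreserving, Matrix.one_mul]

theorem sum_norm_sq_kraus_mulVec [Fintype Y] [DecidableEq X] {K : R → Matrix Y X ℂ}
    (hK : ∑ r, (K r)ᴴ * K r = 1) (u : X → ℂ) :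
    ∑ r, ∑ y, ‖(K r *ᵥ u) y‖ ^ 2 = ∑ x, ‖u x‖ ^ 2 := by
  have hr : ∀ r, star (K r *ᵥ u) ⬝ᵥ (K r *ᵥ u) = star u ⬝ᵥ ((K r)ᴴ * K r) *ᵥ u := fun r => by
    rw [star_mulVec, ← dotProduct_mulVec, mulVec_mulVec]
  apply Complex.ofReal_injective
  rw [Complex.ofReal_sum]
  simp only [ofReal_sum_norm_sq, hr]
  rw [← dotProduct_sum, ← sum_mulVec, hK, one_mulVec]

end Kraus

section TraceNorm

theorem sum_norm_sq_sum_le {ι α : Type*} [Fintype ι] [Fintype α] (f : α → ι → ℂ) (h : α → ℝ)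
    (h0 : ∀ a, 0 ≤ h a) (hf : ∀ a, ∑ i, ‖f a i‖ ^ 2 ≤ h a ^ 2) :
    ∑ i, ‖∑ a, f a i‖ ^ 2 ≤ (∑ a, h a) ^ 2 := by
  have norm_sq_toLp : ∀ g : ι → ℂ, ‖WithLp.toLp 2 g‖ ^ 2 = ∑ i, ‖g i‖ ^ 2 := fun g =>
    EuclideanSpace.norm_sq_eq _
  calc ∑ i, ‖∑ a, f a i‖ ^ 2 = ‖∑ a, WithLp.toLp 2 (f a)‖ ^ 2 := by
        rw [← WithLp.toLp_sum, norm_sq_toLp]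
        simp only [Finset.sum_apply]
    _ ≤ (∑ a, h a) ^ 2 := by
        gcongr
        refine (norm_sum_le _ _).trans (Finset.sum_le_sum fun a _ => ?_)
        exact le_of_sq_le_sq ((norm_sq_toLp _).trans_le (hf a)) (h0 a)

variable {X : Type} [Fintype X] [DecidableEq X]

/-- The singular values of `M`, as in the definition of `traceNorm`. -/
def singularValue (M : Matrix X X ℂ) (x : X) : ℝ :=
  √((isHermitian_conjTranspose_mul_self M).eigenvalues x)

theorem traceNorm_eq_sum_singularValue (M : Matrix X X ℂ) :
    traceNorm M = ∑ x, singularValue M x := rfl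

theorem traceNorm_eq_sum_abs {M : Matrix X X ℂ} {d : X → ℝ}
    (hM : Mᴴ * M = diagonal fun x => (d x : ℂ) ^ 2) : traceNorm M = ∑ x, |d x| := by
  have hroots := (isHermitian_conjTranspose_mul_self M).roots_charpoly_eq_eigenvalues
  rw [show (Mᴴ * M).charpoly = _ from congrArg _ hM, charpoly_diagonal, Polynomial.roots_prod _ _
    (Finset.prod_ne_zero_iff.mpr fun _ _ => Polynomial.X_sub_C_ne_zero _)] at hroots
  simp only [Polynomial.roots_X_sub_C, Multiset.bind_singleton] at hroots
  have hsum := congrArg (fun s : Multiset ℂ => (s.map fun z => √z.re).sum) hroots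
  simp only [Multiset.map_map, Function.comp_def, ← Complex.ofReal_pow, Complex.ofReal_re,
    RCLike.ofReal_eq_complex_ofReal, Real.sqrt_sq_eq_abs] at hsum
  exact hsum.symm

theorem exists_unitary_mul_diagonal_eq {N : Matrix X X ℂ} {d : X → ℝ}
    (hN : Nᴴ * N = diagonal fun x => (d x : ℂ) ^ 2) :
    ∃ U ∈ unitaryGroup X ℂ, U * diagonal (fun x => (d x : ℂ)) = N := by
  let c : X → EuclideanSpace ℂ X := fun x => WithLp.toLp 2 (N.col x)
  have hc : ∀ x y, inner ℂ (c x) (c y) = if x = y then (d x : ℂ) ^ 2 else 0 := fun x y => by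
    have h := congrFun (congrFun hN x) y
    rw [diagonal_apply] at h
    rw [← h, EuclideanSpace.inner_eq_star_dotProduct, dotProduct_comm]
    rfl
  have hortho : Orthonormal ℂ ({x | d x ≠ 0}.domRestrict fun x => (d x : ℂ)⁻¹ • c x) := by
    rw [orthonormal_iff_ite]
    rintro ⟨x, hx⟩ ⟨y, hy⟩
    have hx : (d x : ℂ) ≠ 0 := Complex.ofReal_ne_zero.mpr hx
    by_cases hxy : x = y
    · subst hxy
      simp only [Set.domRestrict_apply, inner_smul_left, inner_smul_right, hc, if_true, map_inv₀,
        Complex.conj_ofReal]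
      field_simp
    · simp [inner_smul_left, inner_smul_right, hc, hxy]
  obtain ⟨b, hb⟩ := hortho.exists_orthonormalBasis_extension_of_card_eq finrank_euclideanSpace
  refine ⟨(EuclideanSpace.basisFun X ℂ).toBasis.toMatrix b,
    OrthonormalBasis.toMatrix_orthonormalBasis_mem_unitary _ b, ext fun y x => ?_⟩
  rw [mul_diagonal, Module.Basis.toMatrix_apply]
  by_cases hx : d x = 0
  · have hcx : c x = 0 := by rw [← inner_self_eq_zero (𝕜 := ℂ), hc, if_pos rfl, hx]; simp
    simpa [hx, c] using (congrFun (congrArg WithLp.ofLp hcx) y).symm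
  · have hx' : (d x : ℂ) ≠ 0 := Complex.ofReal_ne_zero.mpr hx
    have hcx : c x y = N y x := rfl
    rw [hb x hx, EuclideanSpace.basisFun_toBasis, PiLp.basisFun_repr, PiLp.smul_apply, hcx,
      smul_eq_mul]
    field_simp

theorem exists_singularValue_decomposition (M : Matrix X X ℂ) :
    ∃ U ∈ unitaryGroup X ℂ, ∃ V ∈ unitaryGroup X ℂ,
      M = U * diagonal (fun x => (singularValue M x : ℂ)) * Vᴴ := by
  have hH := isHermitian_conjTranspose_mul_self M
  let V : Matrix X X ℂ := hH.eigenvectorUnitary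
  have hV : V ∈ unitaryGroup X ℂ := SetLike.coe_mem _
  have hVV : V * Vᴴ = 1 := mem_unitaryGroup_iff.mp hV
  have hsq : ∀ x, (singularValue M x : ℂ) ^ 2 = (hH.eigenvalues x : ℂ) := fun x => by
    rw [← Complex.ofReal_pow, singularValue,
      Real.sq_sqrt ((posSemidef_conjTranspose_mul_self M).eigenvalues_nonneg x)]
  have hgram : (M * V)ᴴ * (M * V) = diagonal fun x => (singularValue M x : ℂ) ^ 2 := by
    have h := hH.conjStarAlgAut_star_eigenvectorUnitary
    rw [Unitary.conjStarAlgAut_star_apply] at h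
    simp only [hsq, conjTranspose_mul, Matrix.mul_assoc] at h ⊢
    exact h
  obtain ⟨U, hU, hUM⟩ := exists_unitary_mul_diagonal_eq hgram
  exact ⟨U, hU, V, hV, by rw [hUM, Matrix.mul_assoc, hVV, Matrix.mul_one]⟩

theorem exists_unitary_trace_mul_eq (M : Matrix X X ℂ) :
    ∃ W ∈ unitaryGroup X ℂ, (M * W).trace = traceNorm M := by
  obtain ⟨U, hU, V, hV, hM⟩ := exists_singularValue_decomposition M
  refine ⟨V * Uᴴ, mul_mem hV (Unitary.star_mem hU), ?_⟩
  have hUU : Uᴴ * U = 1 := mem_unitaryGroup_iff'.mp hU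
  have hVV : Vᴴ * V = 1 := mem_unitaryGroup_iff'.mp hV
  calc (M * (V * Uᴴ)).trace
      = (U * diagonal (fun x => (singularValue M x : ℂ)) * (Vᴴ * V) * Uᴴ).trace := by
        conv_lhs => rw [hM]
        simp only [Matrix.mul_assoc]
    _ = (Uᴴ * U * diagonal fun x => (singularValue M x : ℂ)).trace := by
        rw [hVV, Matrix.mul_one, trace_mul_comm, Matrix.mul_assoc]
    _ = traceNorm M := by
        rw [hUU, Matrix.one_mul, trace_diagonal, traceNorm_eq_sum_singularValue,
          Complex.ofReal_sum]

theorem sum_norm_sq_trace_mul_kraus_le {R : Type} [Fintype R] (M : Matrix X X ℂ)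
    {K : R → Matrix X X ℂ} (hK : ∑ r, (K r)ᴴ * K r = 1) :
    ∑ r, ‖(M * K r).trace‖ ^ 2 ≤ traceNorm M ^ 2 := by
  obtain ⟨U, hU, V, hV, hM⟩ := exists_singularValue_decomposition M
  have hUU : Uᴴ * U = 1 := mem_unitaryGroup_iff'.mp hU
  have hVV : V * Vᴴ = 1 := mem_unitaryGroup_iff.mp hV
  let L : R → Matrix X X ℂ := fun r => Vᴴ * K r * U
  have hL : ∑ r, (L r)ᴴ * L r = 1 := by
    have hr : ∀ r, (L r)ᴴ * L r = Uᴴ * ((K r)ᴴ * K r) * U := fun r => by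
      simp only [L, conjTranspose_mul, conjTranspose_conjTranspose, Matrix.mul_assoc]
      rw [← Matrix.mul_assoc V, hVV, Matrix.one_mul]
    simp only [hr]
    rw [← Finset.sum_mul, ← Finset.mul_sum, hK, Matrix.mul_one, hUU]
  have htrace : ∀ r, (M * K r).trace = ∑ x, (singularValue M x : ℂ) * L r x x := fun r => by
    conv_lhs => rw [hM, Matrix.mul_assoc, Matrix.mul_assoc, trace_mul_comm, Matrix.mul_assoc]
    simp only [trace, diag_apply, diagonal_mul, L]
  simp only [htrace]
  refine sum_norm_sq_sum_le (fun x r => (singularValue M x : ℂ) * L r x x) (singularValue M)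
    (fun x => Real.sqrt_nonneg _) fun x => ?_
  simp only [norm_mul, mul_pow, ← Finset.mul_sum, Complex.norm_real, Real.norm_eq_abs, sq_abs]
  refine mul_le_of_le_one_right (sq_nonneg _) ?_
  rw [← sum_norm_sq_kraus_col hL x]
  exact Finset.sum_le_sum fun r _ => Finset.single_le_sum (f := fun y => ‖L r y x‖ ^ 2)
    (fun _ _ => sq_nonneg _) (Finset.mem_univ x)

end TraceNorm

section Ampliation

variable {R X Y E I : Type} [Fintype R]

theorem ampliate_sum (T : Matrix X X ℂ →ₗ[ℂ] Matrix Y Y ℂ) (ρ : R → Matrix (X × E) (X × E) ℂ) :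
    ampliate T (∑ r, ρ r) = ∑ r, ampliate T (ρ r) := by
  let block (e e' : E) (σ : Matrix (X × E) (X × E) ℂ) : Matrix X X ℂ :=
    σ.submatrix (·, e) (·, e')
  have hblock : ∀ e e', block e e' (∑ r, ρ r) = ∑ r, block e e' (ρ r) := fun e e' => by
    ext x x'
    simp only [block, submatrix_apply, Matrix.sum_apply]
  ext p q
  change T (block p.2 q.2 (∑ r, ρ r)) p.1 q.1 = _
  rw [hblock, map_sum]
  simp only [Matrix.sum_apply]
  rfl

theorem submatrix_ampliate_krausMap_ketbra [Fintype X] (K : R → Matrix Y X ℂ) (v : X × E → ℂ)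
    (e : I → Y × E) :
    (ampliate (krausMap K) (ketbra v)).submatrix e e =
      ∑ r, ketbra fun i => (K r *ᵥ fun x => v (x, (e i).2)) (e i).1 := by
  ext i j
  change krausMap K (vecMulVec (fun x => v (x, (e i).2)) (star fun x => v (x, (e j).2)))
    (e i).1 (e j).1 = _
  simp only [krausMap_apply, mul_vecMulVec, vecMulVec_mul, ← star_mulVec, Matrix.sum_apply, ketbra,
    vecMulVec_apply, Pi.star_apply]

end Ampliation

namespace RankOneGame

variable {A B C R S : Type} [Fintype A] [Fintype B] [Fintype C] [Fintype R] [Fintype S]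

theorem star_γ_dotProduct_eq_trace (G : RankOneGame A B C) (N : Matrix (A × B) (A × B) ℂ) :
    star G.γ ⬝ᵥ (fun x => (N *ᵥ fun p => G.ψ (p.1, p.2, x.2.2)) (x.1, x.2.1)) =
      (G.M * N).trace := by
  calc star G.γ ⬝ᵥ (fun x => (N *ᵥ fun p => G.ψ (p.1, p.2, x.2.2)) (x.1, x.2.1))
      = ∑ q : A × B, ∑ c, star (G.γ (q.1, q.2, c)) * ∑ p, N q p * G.ψ (p.1, p.2, c) := by
        simp only [dotProduct, mulVec, Fintype.sum_prod_type, Pi.star_apply]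
    _ = ∑ q, ∑ p, N q p * G.M p q := by
        refine Finset.sum_congr rfl fun q _ => ?_
        simp only [M, Finset.mul_sum]
        rw [Finset.sum_comm]
        refine Finset.sum_congr rfl fun p _ => Finset.sum_congr rfl fun c _ => ?_
        ring
    _ = (G.M * N).trace := by
        rw [trace_mul_comm]
        simp only [trace, diag_apply, mul_apply]

theorem singleWinProb_krausMap (G : RankOneGame A B C)
    (K : R → Matrix (A × B) (A × B) ℂ) :
    G.singleWinProb (krausMap K) = ∑ r, ‖(G.M * K r).trace‖ ^ 2 := by
  rw [singleWinProb, submatrix_ampliate_krausMap_ketbra, Finset.mul_sum, trace_sum,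
    Complex.re_sum]
  simp only [re_trace_ketbra_mul_ketbra, ← star_γ_dotProduct_eq_trace]

theorem singlePlayerValue_eq_V [DecidableEq A] [DecidableEq B] (G : RankOneGame A B C) :
    G.singlePlayerValue = G.V := by
  refine IsGreatest.csSup_eq ⟨?_, ?_⟩
  · obtain ⟨W, hW, htrace⟩ := exists_unitary_trace_mul_eq G.M
    have hK : ∑ _ : Unit, Wᴴ * W = 1 := by
      rw [Finset.univ_unique, Finset.sum_singleton]
      exact mem_unitaryGroup_iff'.mp hW
    refine ⟨krausMap fun _ : Unit => W, isQuantumOperation_krausMap hK, ?_⟩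
    simp [singleWinProb_krausMap, htrace, V]
  · rintro _ ⟨T, hT, rfl⟩
    obtain ⟨k, K, hK, rfl⟩ := hT.exists_kraus
    rw [singleWinProb_krausMap]
    exact sum_norm_sq_trace_mul_kraus_le G.M hK

/-- The operator on `H_A ⊗ H_B` obtained when Alice applies `K` and Bob applies `L`, with the
message register prepared in `|z₀⟩` and found in `|w⟩` at the end. -/
def relay {D : Type} [Fintype D] (K : Matrix (A × D) (A × D) ℂ) (L : Matrix (B × D) (B × D) ℂ)
    (z₀ w : D) : Matrix (A × B) (A × B) ℂ :=
  of fun p q => ∑ z, L (p.2, w) (q.2, z) * K (p.1, z) (q.1, z₀)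

theorem relay_mulVec {D : Type} [Fintype D] [DecidableEq D] (K : Matrix (A × D) (A × D) ℂ)
    (L : Matrix (B × D) (B × D) ℂ) (z₀ w : D) (v : A × B → ℂ) (a : A) (b : B) :
    (relay K L z₀ w *ᵥ v) (a, b) = (L *ᵥ fun y => (K *ᵥ fun x =>
      v (x.1, y.1) * (if x.2 = z₀ then 1 else 0)) (a, y.2)) (b, w) := by
  simp only [relay, mulVec, dotProduct, of_apply, Fintype.sum_prod_type, mul_ite, mul_one,
    mul_zero, Finset.sum_ite_eq', Finset.mem_univ, if_true, Finset.sum_mul, Finset.mul_sum]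
  rw [← Finset.sum_comm_cycle]
  refine Finset.sum_congr rfl fun b' _ => Finset.sum_congr rfl fun z _ =>
    Finset.sum_congr rfl fun a' _ => ?_
  ring

theorem qowWinProb_krausMap (G : RankOneGame A B C) {d : ℕ}
    (K : R → Matrix (A × Fin (d + 1)) (A × Fin (d + 1)) ℂ)
    (L : S → Matrix (B × Fin (d + 1)) (B × Fin (d + 1)) ℂ) :
    G.qowWinProb d (krausMap K) (krausMap L) =
      ∑ r, ∑ s, ∑ w, ‖(G.M * relay (K r) (L s) 0 w).trace‖ ^ 2 := by
  rw [qowWinProb, submatrix_ampliate_krausMap_ketbra, ampliate_sum]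
  have hsum : ∀ {I J : Type} (ρ : R → Matrix I I ℂ) (e : J → I),
      (∑ r, ρ r).submatrix e e = ∑ r, (ρ r).submatrix e e := fun ρ e => by
    ext; simp only [submatrix_apply, Matrix.sum_apply]
  simp only [hsum, submatrix_ampliate_krausMap_ketbra, Finset.mul_sum, trace_sum, Complex.re_sum,
    re_trace_ketbra_kronecker_one_mul_ketbra, ← star_γ_dotProduct_eq_trace, relay_mulVec]

end RankOneGame

theorem exists_perm_fst_apply_zero {A : Type*} [Finite A] (f : A → A) :
    ∃ (d : ℕ) (σ : Equiv.Perm (A × Fin (d + 1))), ∀ a, (σ (a, 0)).1 = f a := by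
  let e : A → Fin (Nat.card A + 1) := fun a => (Finite.equivFin A a).castSucc
  have he : Function.Injective e :=
    (Fin.castSucc_injective _).comp (Finite.equivFin A).injective
  obtain ⟨σ, hσ⟩ := Equiv.Perm.exists_extending_pair
    (fun a => (a, (0 : Fin (Nat.card A + 1)))) (fun a => (f a, e a))
    (fun _ _ h => congrArg Prod.fst h) (fun _ _ h => he (congrArg Prod.snd h))
  exact ⟨_, σ, fun a => by rw [hσ]⟩

section WeightedSwap

variable {A : Type} [DecidableEq A]

/-- The operator on `ℂ^A ⊗ ℂ^A` that exchanges the two registers and rescales: it sends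
`|a⟩|b⟩` to `m (b, a) |b⟩|a⟩`. -/
def weightedSwap (m : A × A → ℝ) : Matrix (A × A) (A × A) ℂ :=
  of fun p q => if q = p.swap then (m p : ℂ) else 0

theorem weightedSwap_apply (m : A × A → ℝ) (p q : A × A) :
    weightedSwap m p q = if q = p.swap then (m p : ℂ) else 0 := rfl

variable [Fintype A]

theorem traceNorm_weightedSwap (m : A × A → ℝ) : traceNorm (weightedSwap m) = ∑ p, |m p| := by
  have hgram : (weightedSwap m)ᴴ * weightedSwap m = diagonal fun p => (m p.swap : ℂ) ^ 2 := by
    ext p q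
    simp only [mul_apply, conjTranspose_apply, weightedSwap_apply, diagonal_apply,
      ← Prod.swap_eq_iff_eq_swap]
    by_cases hpq : p = q
    · subst hpq
      simp [pow_two]
    · simp [hpq]
  rw [traceNorm_eq_sum_abs (d := fun p => m p.swap) hgram]
  exact Equiv.sum_comp (Equiv.prodComm A A) fun p => |m p|

theorem trace_weightedSwap_mul (m : A × A → ℝ) (N : Matrix (A × A) (A × A) ℂ) :
    (weightedSwap m * N).trace = ∑ p, (m p : ℂ) * N p.swap p := by
  simp only [trace, diag_apply, mul_apply, weightedSwap_apply, ite_mul, zero_mul,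
    Finset.sum_ite_eq', Finset.mem_univ, if_true]

theorem trace_weightedSwap_mul_relay {D : Type} [Fintype D] (m : A × A → ℝ)
    (K L : Matrix (A × D) (A × D) ℂ) (z₀ w : D) :
    (weightedSwap m * RankOneGame.relay K L z₀ w).trace =
      ∑ a, (L *ᵥ fun y => (m (a, y.1) : ℂ) * K y (a, z₀)) (a, w) := by
  simp only [trace_weightedSwap_mul, RankOneGame.relay, of_apply, Fintype.sum_prod_type, mulVec,
    dotProduct, Finset.mul_sum, Prod.swap_prod_mk]
  refine Finset.sum_congr rfl fun a _ => Finset.sum_congr rfl fun x _ =>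
    Finset.sum_congr rfl fun z _ => ?_
  ring

theorem sum_norm_sq_kraus_mulVec_weighted_le {R S D : Type} [Fintype R] [Fintype S]
    [Fintype D] [DecidableEq D] {K : R → Matrix (A × D) (A × D) ℂ}
    {L : S → Matrix (A × D) (A × D) ℂ}
    (hK : ∑ r, (K r)ᴴ * K r = 1) (hL : ∑ s, (L s)ᴴ * L s = 1)
    {c : A × D → ℂ} {b : ℝ} (hc : ∀ y, ‖c y‖ ≤ b) (x : A × D) (a : A) :
    ∑ r, ∑ s, ∑ w, ‖(L s *ᵥ fun y => c y * K r y x) (a, w)‖ ^ 2 ≤ b ^ 2 :=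
  calc ∑ r, ∑ s, ∑ w, ‖(L s *ᵥ fun y => c y * K r y x) (a, w)‖ ^ 2
      ≤ ∑ r, ∑ s, ∑ y', ‖(L s *ᵥ fun y => c y * K r y x) y'‖ ^ 2 := by
        gcongr with r _ s _
        rw [Fintype.sum_prod_type]
        exact Finset.single_le_sum
          (f := fun a => ∑ w, ‖(L s *ᵥ fun y => c y * K r y x) (a, w)‖ ^ 2)
          (fun _ _ => Finset.sum_nonneg fun _ _ => sq_nonneg _) (Finset.mem_univ a)
    _ = ∑ r, ∑ y, ‖c y‖ ^ 2 * ‖K r y x‖ ^ 2 := by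
        simp only [sum_norm_sq_kraus_mulVec hL, norm_mul, mul_pow]
    _ ≤ ∑ r, ∑ y, b ^ 2 * ‖K r y x‖ ^ 2 := by
        gcongr
        exact hc _
    _ = b ^ 2 := by
        simp only [← Finset.mul_sum]
        rw [sum_norm_sq_kraus_col hK, mul_one]

theorem trace_weightedSwap_mul_relay_permMatrix {D : Type} [Fintype D] [DecidableEq D]
    (m : A × A → ℝ) (σ : Equiv.Perm (A × D)) (z₀ w : D) :
    (weightedSwap m * RankOneGame.relay (σ⁻¹.permMatrix ℂ) (σ.permMatrix ℂ) z₀ w).trace =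
      if w = z₀ then ((∑ a, m (a, (σ (a, z₀)).1) : ℝ) : ℂ) else 0 := by
  simp only [trace_weightedSwap_mul_relay, permMatrix_mulVec, Function.comp_apply]
  split_ifs with hw <;> simp [PEquiv.toMatrix_apply, hw]

theorem conjTranspose_permMatrix_mul_self (σ : Equiv.Perm A) :
    (σ.permMatrix ℂ)ᴴ * σ.permMatrix ℂ = 1 := by
  rw [conjTranspose_permMatrix, ← permMatrix_mul, mul_inv_cancel, permMatrix_one]

end WeightedSwap

section SqWeight

variable {A : Type*}

/-- The weights of `M_AB` for `G²` when those for `G` are `m`. An index groups the two copies of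
Alice's register, then the two copies of Bob's. -/
def sqWeight (m : A × A → ℝ) : (A × A) × (A × A) → ℝ :=
  fun p => m (p.1.1, p.2.1) * m (p.1.2, p.2.2)

theorem sqWeight_nonneg {m : A × A → ℝ} (hm : ∀ p, 0 ≤ m p)
    (p : (A × A) × (A × A)) : 0 ≤ sqWeight m p :=
  mul_nonneg (hm _) (hm _)

theorem sqWeight_le {m : A × A → ℝ} (hm : ∀ p, 0 ≤ m p) {f : A → A}
    (hf : ∀ a x, m (a, x) ≤ m (a, f a)) (a x : A × A) :
    sqWeight m (a, x) ≤ sqWeight m (a, Prod.map f f a) :=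
  mul_le_mul (hf _ _) (hf _ _) (hm _) (hm _)

theorem sum_sqWeight [Fintype A] (m : A × A → ℝ) :
    ∑ p, sqWeight m p = (∑ p, m p) ^ 2 := by
  rw [pow_two, Finset.sum_mul_sum, ← Fintype.sum_prod_type']
  exact Equiv.sum_comp (Equiv.prodProdProdComm A A A A) fun q => m q.1 * m q.2

theorem sum_sqWeight_map [Fintype A] (m : A × A → ℝ) (f : A → A) :
    ∑ a, sqWeight m (a, Prod.map f f a) = (∑ a, m (a, f a)) ^ 2 := by
  rw [pow_two, Finset.sum_mul_sum, ← Fintype.sum_prod_type']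
  rfl

end SqWeight

namespace RankOneGame

theorem M_sq {A B C : Type} [Fintype A] [Fintype B] [Fintype C] (G : RankOneGame A B C)
    (p q : (A × A) × (B × B)) :
    G.sq.M p q = G.M (p.1.1, p.2.1) (q.1.1, q.2.1) * G.M (p.1.2, p.2.2) (q.1.2, q.2.2) := by
  simp only [M, Finset.sum_mul_sum, Fintype.sum_prod_type, sq, star_mul']
  refine Finset.sum_congr rfl fun _ _ => Finset.sum_congr rfl fun _ _ => ?_
  ring

variable {A C : Type} [Fintype A] [DecidableEq A] [Fintype C]
  {G : RankOneGame A A C} {m : A × A → ℝ}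

theorem V_eq_of_M_eq_weightedSwap (hG : G.M = weightedSwap m) : G.V = (∑ p, |m p|) ^ 2 := by
  rw [V, hG, traceNorm_weightedSwap]

theorem exists_qowWinProb_eq_of_M_eq_weightedSwap (hG : G.M = weightedSwap m) (f : A → A) :
    ∃ d T S, IsQuantumOperation T ∧ IsQuantumOperation S ∧
      (∑ a, m (a, f a)) ^ 2 = G.qowWinProb d T S := by
  obtain ⟨d, σ, hσ⟩ := exists_perm_fst_apply_zero f
  -- As `G.M` exchanges the two registers, Bob holds what Alice held and can undo her permutation.
  refine ⟨d, krausMap fun _ : Unit => σ⁻¹.permMatrix ℂ, krausMap fun _ : Unit => σ.permMatrix ℂ,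
    isQuantumOperation_krausMap ?_, isQuantumOperation_krausMap ?_, ?_⟩
  iterate 2 rw [Finset.univ_unique, Finset.sum_singleton, conjTranspose_permMatrix_mul_self]
  simp only [qowWinProb_krausMap, hG, trace_weightedSwap_mul_relay_permMatrix, hσ,
    Finset.univ_unique, Finset.sum_singleton, apply_ite norm, norm_zero, ite_pow,
    Complex.norm_real, Real.norm_eq_abs, sq_abs, zero_pow two_ne_zero, Finset.sum_ite_eq',
    Finset.mem_univ, if_true]

theorem qowWinProb_le_of_M_eq_weightedSwap (hG : G.M = weightedSwap m) {b : A → ℝ}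
    (hb : ∀ a x, |m (a, x)| ≤ b a) {d : ℕ}
    {T S : Matrix (A × Fin (d + 1)) (A × Fin (d + 1)) ℂ →ₗ[ℂ]
      Matrix (A × Fin (d + 1)) (A × Fin (d + 1)) ℂ}
    (hT : IsQuantumOperation T) (hS : IsQuantumOperation S) :
    G.qowWinProb d T S ≤ (∑ a, b a) ^ 2 := by
  obtain ⟨k, K, hK, rfl⟩ := hT.exists_kraus
  obtain ⟨l, L, hL, rfl⟩ := hS.exists_kraus
  have hnorm : ∀ a (y : A × Fin (d + 1)), ‖(m (a, y.1) : ℂ)‖ ≤ b a := fun a y => by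
    rw [Complex.norm_real]
    exact hb a y.1
  have hamp := sum_norm_sq_sum_le
    (fun a (i : Fin k × Fin l × Fin (d + 1)) =>
      (L i.2.1 *ᵥ fun y => (m (a, y.1) : ℂ) * K i.1 y (a, 0)) (a, i.2.2))
    b (fun a => (abs_nonneg _).trans (hb a a)) fun a => by
      simp only [Fintype.sum_prod_type]
      exact sum_norm_sq_kraus_mulVec_weighted_le hK hL (hnorm a) (a, 0) a
  simpa only [qowWinProb_krausMap, hG, trace_weightedSwap_mul_relay, Fintype.sum_prod_type]
    using hamp

theorem omegaQow_eq_of_M_eq_weightedSwap (hG : G.M = weightedSwap m) (hm : ∀ p, 0 ≤ m p)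
    {f : A → A} (hf : ∀ a x, m (a, x) ≤ m (a, f a)) : G.omegaQow = (∑ a, m (a, f a)) ^ 2 := by
  refine IsGreatest.csSup_eq ⟨exists_qowWinProb_eq_of_M_eq_weightedSwap hG f, ?_⟩
  rintro _ ⟨d, T, S, hT, hS, rfl⟩
  exact qowWinProb_le_of_M_eq_weightedSwap hG
    (fun a x => (abs_of_nonneg (hm _)).trans_le (hf a x)) hT hS

theorem M_sq_eq_weightedSwap (hG : G.M = weightedSwap m) :
    G.sq.M = weightedSwap (sqWeight m) := by
  ext ⟨⟨p₁, p₂⟩, p₃, p₄⟩ ⟨⟨q₁, q₂⟩, q₃, q₄⟩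
  simp only [M_sq, hG, weightedSwap_apply, sqWeight, Prod.swap_prod_mk, Prod.mk.injEq, ite_and]
  split_ifs <;> simp_all

end RankOneGame

section CR

variable (n : ℕ) [NeZero n]

/-- The weights of `M_AB` for the game `G_{C+R}`, which is a weighted swap. -/
def weightCR (p : Fin n × Fin n) : ℝ :=
  ((if p.2 = 0 then 1 else 0) + (if p.1 = 0 then 1 else 0)) / (2 * n)

theorem weightCR_nonneg (p : Fin n × Fin n) : 0 ≤ weightCR n p := by
  unfold weightCR
  positivity

theorem weightCR_le (a x : Fin n) : weightCR n (a, x) ≤ weightCR n (a, 0) := by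
  unfold weightCR
  gcongr
  by_cases h : x = 0 <;> simp [h]

theorem sum_weightCR_column : ∑ a, weightCR n (a, 0) = 1 / 2 * (1 + 1 / (n : ℝ)) := by
  have hn : (n : ℝ) ≠ 0 := Nat.cast_ne_zero.mpr (NeZero.ne n)
  simp only [weightCR, ← Finset.sum_div, Finset.sum_add_distrib, if_true, Finset.sum_const,
    Finset.card_univ, Fintype.card_fin, Finset.sum_ite_eq', Finset.mem_univ, nsmul_eq_mul, mul_one]
  field_simp

theorem sum_weightCR : ∑ p, weightCR n p = 1 := by
  have hn : (n : ℝ) ≠ 0 := Nat.cast_ne_zero.mpr (NeZero.ne n)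
  have hfst : ∑ p : Fin n × Fin n, (if p.1 = 0 then (1 : ℝ) else 0) = n := by
    rw [Fintype.sum_prod_type_right]
    simp
  have hsnd : ∑ p : Fin n × Fin n, (if p.2 = 0 then (1 : ℝ) else 0) = n := by
    rw [Fintype.sum_prod_type]
    simp
  simp only [weightCR, ← Finset.sum_div, Finset.sum_add_distrib, hfst, hsnd]
  field_simp
  norm_num

theorem psiCR_zero (a b k : Fin n) : psiCR n (a, b, (k, 0)) =
    ((1 / √(2 * n) : ℝ) : ℂ) * (if k = a ∧ b = 0 then 1 else 0) := by
  by_cases hb : b = 0 <;> simp [psiCR, ite_and, eq_comm (a := a), hb]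

theorem psiCR_one (a b k : Fin n) : psiCR n (a, b, (k, 1)) =
    ((1 / √(2 * n) : ℝ) : ℂ) * (if k = b ∧ a = 0 then 1 else 0) := by
  by_cases ha : a = 0 <;> simp [psiCR, ite_and, eq_comm (a := b), ha]

theorem gammaCR_eq_psiCR_swap (a b : Fin n) (c : Fin n × Fin 2) :
    gammaCR n (a, b, c) = psiCR n (b, a, c) := by
  simp only [gammaCR, psiCR, Prod.mk.injEq, and_left_comm]

theorem sum_psiCR_mul_star_psiCR (a b a' b' : Fin n) :
    ∑ c, psiCR n (a, b, c) * star (psiCR n (a', b', c)) =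
      if (a', b') = (a, b) then (weightCR n (a, b) : ℂ) else 0 := by
  have hc : ((1 / √(2 * n) : ℝ) : ℂ) * ((1 / √(2 * n) : ℝ) : ℂ) = 1 / (2 * n) := by
    rw [← Complex.ofReal_mul, ← sq, div_pow, Real.sq_sqrt (by positivity)]
    push_cast
    ring
  have hterm : ∀ (P Q : Prop) [Decidable P] [Decidable Q],
      ((1 / √(2 * n) : ℝ) : ℂ) * (if P then 1 else 0) *
        star (((1 / √(2 * n) : ℝ) : ℂ) * (if Q then 1 else 0)) =
      1 / (2 * n) * if P ∧ Q then 1 else 0 := fun P Q _ _ => by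
    by_cases hP : P <;> by_cases hQ : Q <;> simp [hP, hQ, ← hc]
  have hfst : ∀ k, ((k = a ∧ b = 0) ∧ k = a' ∧ b' = 0) ↔ k = a ∧ (a', b') = (a, b) ∧ b = 0 := by
    grind
  have hsnd : ∀ k, ((k = b ∧ a = 0) ∧ k = b' ∧ a' = 0) ↔ k = b ∧ (a', b') = (a, b) ∧ a = 0 := by
    grind
  simp only [Fintype.sum_prod_type, Fin.sum_univ_two, psiCR_zero, psiCR_one, hterm, hfst, hsnd,
    Finset.sum_add_distrib, ← Finset.mul_sum]
  by_cases h : (a', b') = (a, b)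
  · simp only [h, true_and, ite_and, Finset.sum_ite_eq', Finset.mem_univ, if_true, weightCR]
    split_ifs <;> push_cast <;> ring
  · simp only [h, false_and, and_false, if_false, Finset.sum_const_zero, mul_zero, add_zero]

theorem M_gameCR : (gameCR n).M = weightedSwap (weightCR n) := by
  ext ⟨a, b⟩ ⟨a', b'⟩
  calc (gameCR n).M (a, b) (a', b')
      = ∑ c, psiCR n (a, b, c) * star (psiCR n (b', a', c)) := by
        simp only [RankOneGame.M, gameCR, gammaCR_eq_psiCR_swap]
    _ = weightedSwap (weightCR n) (a, b) (a', b') := by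
        simp only [sum_psiCR_mul_star_psiCR, weightedSwap_apply, Prod.swap_prod_mk, Prod.mk.injEq,
          and_comm]

end CR

end QGame

end

theorem mainTheorem11 (n : ℕ) [NeZero n] :
    ((QGame.gameCR n).V = 1 ∧ (QGame.gameCR n).sq.V = 1) ∧
    ((QGame.gameCR n).singlePlayerValue = 1 ∧ (QGame.gameCR n).sq.singlePlayerValue = 1) ∧
    (QGame.gameCR n).omegaQow = 1 / 4 * (1 + 1 / (n : ℝ)) ^ 2 ∧
    (QGame.gameCR n).sq.omegaQow = 1 / 16 * (1 + 1 / (n : ℝ)) ^ 4 := by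
  have hM := QGame.M_gameCR n
  have hM₂ := QGame.RankOneGame.M_sq_eq_weightedSwap hM
  have hm := QGame.weightCR_nonneg n
  have hm₂ := QGame.sqWeight_nonneg hm
  have hmax := QGame.weightCR_le n
  have hV : (QGame.gameCR n).V = 1 := by
    rw [QGame.RankOneGame.V_eq_of_M_eq_weightedSwap hM]
    simp only [abs_of_nonneg (hm _), QGame.sum_weightCR, one_pow]
  have hV₂ : (QGame.gameCR n).sq.V = 1 := by
    rw [QGame.RankOneGame.V_eq_of_M_eq_weightedSwap hM₂]
    simp only [abs_of_nonneg (hm₂ _), QGame.sum_sqWeight, QGame.sum_weightCR, one_pow]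
  refine ⟨⟨hV, hV₂⟩, ⟨?_, ?_⟩, ?_, ?_⟩
  · rw [QGame.RankOneGame.singlePlayerValue_eq_V, hV]
  · rw [QGame.RankOneGame.singlePlayerValue_eq_V, hV₂]
  · rw [QGame.RankOneGame.omegaQow_eq_of_M_eq_weightedSwap hM hm hmax, QGame.sum_weightCR_column]
    ring
  · rw [QGame.RankOneGame.omegaQow_eq_of_M_eq_weightedSwap hM₂ hm₂ (QGame.sqWeight_le hm hmax),
      QGame.sum_sqWeight_map, QGame.sum_weightCR_column]
    ring
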